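/- All grammars are context-free grammars $G=(\Sigma,N,P,S)$ with a finite non-empty terminal alphabet $\Sigma$, a finite nonterminal alphabet $N$ (disjoint from $\Sigma$), a finite rule set $P\subseteq N\times(\Sigma\cup N)^*$ and axiom $S\in N$; two grammars are equivalent if they generate the same language. $G$ is in Chomsky normal form (CNF) if every right-hand side is in $\Sigma\cup NN$. For $r\ge 1$, $G$ is quotiented of order $r$ if $S$ occurs in no right-hand side and $P=P_q\cup P_r$ is a disjoint union with $P_q\subseteq\{S\}\times N\Sigma^{<r}$ and $P_r\subseteq (N\setminus\{S\})\times(N\cup\Sigma^r)^*$, where $\Sigma^{<r}$ is the set of words of length less than $r$. If in addition $P_r\subseteq N\times(NN\cup\Sigma^r\cup\{\varepsilon\})$, it is a Q-CNF grammar of order $r$; if instead $P_r\subseteq N\times(\Sigma^rN^*\Sigma^r\cup\Sigma^r\cup\{\varepsilon\})$, it is a Q-DGNF grammar of order $r$. **Lemma.** For every grammar $G=(\Sigma,N,P,S)$ in CNF and every $r\ge 1$ there exist an equivalent Q-CNF grammar $G'=(\Sigma,N',P',S')$ and an equivalent Q-DGNF grammar $G''=(\Sigma,N'',P'',S'')$,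 both of order $r$, such that $$|N'|\in O(|N|\cdot|\Sigma|^{2r}),\qquad |P'|\in O(|P|\cdot|\Sigma|^{3r}),$$ $$|P''|\in O(|\Sigma|^{6r}\cdot|N'|^8)\qquad\text{and}\qquad |P''|\in O(|\Sigma|^{22r}\cdot|N|^8).$$ The constant in these bounds is absolute for $|\Sigma|\ge 2$ (independent of $G$, $\Sigma$ and $r$); for $|\Sigma|=1$ it may depend on $r$, but on nothing else. -/

import Mathlib

namespace ContextFreeGrammar

/-- Chomsky normal form: every right-hand side is in `Σ` or in `N N`. -/
def IsCNF {T : Type*} (g : ContextFreeGrammar T) : Prop :=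
  ∀ p ∈ g.rules,
    (∃ a : T, p.output = [Symbol.terminal a]) ∨
    (∃ B C : g.NT, p.output = [Symbol.nonterminal B, Symbol.nonterminal C])

/-- A grammar is quotiented of order `r` if the axiom `S` does not occur in any right-hand side,
every rule for the axiom is in `{S} × N Σ^{<r}`, and every other rule is in
`(N - {S}) × (N ∪ Σ^r)^*`.  (The partition of the rules is determined by the left-hand sides.) -/
structure IsQuotiented {T : Type*} (r : ℕ) (g : ContextFreeGrammar T) : Prop where
  axiom_not_mem : ∀ p ∈ g.rules, Symbol.nonterminal g.initial ∉ p.output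
  axiom_rules : ∀ p ∈ g.rules, p.input = g.initial →
    ∃ (X : g.NT) (w : List T), w.length < r ∧
      p.output = Symbol.nonterminal X :: w.map Symbol.terminal
  other_rules : ∀ p ∈ g.rules, p.input ≠ g.initial →
    ∃ l : List (List (Symbol T g.NT)), p.output = l.flatten ∧
      ∀ b ∈ l, (∃ X : g.NT, b = [Symbol.nonterminal X]) ∨
        (∃ w : List T, w.length = r ∧ b = w.map Symbol.terminal)

/-- Quotiented Chomsky normal form of order `r`: the right-hand sides of the rules for the
nonterminals other than the axiom are in `N N`, in `Σ^r`, or empty. -/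
structure IsQCNF {T : Type*} (r : ℕ) (g : ContextFreeGrammar T) : Prop
    extends IsQuotiented r g where
  cnf_rules : ∀ p ∈ g.rules, p.input ≠ g.initial →
    (∃ B C : g.NT, p.output = [Symbol.nonterminal B, Symbol.nonterminal C]) ∨
    (∃ w : List T, w.length = r ∧ p.output = w.map Symbol.terminal) ∨
    p.output = []

/-- Quotiented double Greibach normal form of order `r`: the right-hand sides of the rules for the
nonterminals other than the axiom are in `Σ^r N^* Σ^r`, in `Σ^r`, or empty. -/
structure IsQDGNF {T : Type*} (r : ℕ) (g : ContextFreeGrammar T) : Prop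
    extends IsQuotiented r g where
  dgnf_rules : ∀ p ∈ g.rules, p.input ≠ g.initial →
    (∃ (u v : List T) (Y : List g.NT), u.length = r ∧ v.length = r ∧
      p.output = u.map Symbol.terminal ++ Y.map Symbol.nonterminal ++ v.map Symbol.terminal) ∨
    (∃ w : List T, w.length = r ∧ p.output = w.map Symbol.terminal) ∨
    p.output = []

end ContextFreeGrammar

/-!
Both normal forms come from quotients of the languages `L(A)` of the nonterminals. For words `u` and
`v` shorter than `r`, let `L(u, A, v)` be the set of words of length divisible by `r` in
`u · L(A) · v⁻¹`, regarded as words over the alphabet `Σ^r` of blocks. A rule `A → BC` gives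
`L(u, B, z) · L(z, C, v) ⊆ L(u, A, v)` for every short word `z`, every word of `L(u, A, v)` that
comes from this rule is obtained for a suitable `z`, and a rule `A → a` contributes only the empty
word and single blocks. So the triples are the nonterminals of a Q-CNF grammar
(`IsCNF.exists_isQCNF`), whose axiom puts back the last incomplete block.

For the Q-DGNF only the following property of the family `L(u, A, v)` matters (`Splits`): every word
of at least two blocks in a member `L X` is a product of nonempty words from two members whose
product is contained in `L X`. It makes a binary tree out of each word. Besides the members `X`
themselves, take as nonterminals the residuals `right X Y` and `left X Y`, which generate what
stands beside the path from `X` down to `Y`, when `Y` lies on the leftmost or the rightmost branch.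
A word beside a leftmost branch is `v ++ m ++ d`, where `v` hangs off the lowest and `d` off the
highest node of the branch; taking the left corner `a` of `v` and the right corner `b` of `d` out
turns it into `a p m s b`, where `p`, `m`, `s` again are words beside spines. This is a rule
`A → a P Q R b`, and a word of a member splits in the same way with `m` empty
(`Splits.soundGen`). There are `n + 2 n²` nonterminals for `n` triples, and four of them in a rule,
whence the exponent `8`.

The grammar may as well contain all rules of these forms that are sound for the residuals, because
the bound counts the possible rules only. Soundness of a grammar for an assignment of languages to
nonterminals is checked rule by rule (`Derives.formLang_le`), with a sentential form interpreted as
a product of languages.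
-/

/-! ### Interpreting sentential forms as languages -/

namespace ContextFreeGrammar

section Interpretation

variable {T : Type*}

/-- The language of a symbol when every nonterminal `A` is interpreted as the language `M A`. -/
def symbolLang {N : Type*} (M : N → Language T) : Symbol T N → Language T
  | .terminal a => {[a]}
  | .nonterminal A => M A

/-- The language of a sentential form under the interpretation `M` of the nonterminals: the product
of the languages of its symbols. -/
def formLang {N : Type*} (M : N → Language T) (s : List (Symbol T N)) : Language T :=
  (s.map (symbolLang M)).prod

variable {N : Type*} {M : N → Language T}

lemma formLang_append (s t : List (Symbol T N)) :
    formLang M (s ++ t) = formLang M s * formLang M t := by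
  simp [formLang]

lemma formLang_nonterminal (A : N) : formLang M [.nonterminal A] = M A := by
  simp [formLang, symbolLang]

lemma mem_formLang_pair {A B : N} {x : List T} :
    x ∈ formLang M [.nonterminal A, .nonterminal B] ↔ ∃ y ∈ M A, ∃ z ∈ M B, x = y ++ z := by
  simp [formLang, symbolLang, Language.mem_mul, eq_comm]

lemma mem_formLang_terminals {w x : List T} :
    x ∈ formLang M (w.map .terminal) ↔ x = w := by
  induction w generalizing x with
  | nil => simp [formLang]
  | cons a w ih =>
    have h : formLang M ((a :: w).map .terminal) =
        symbolLang M (.terminal a) * formLang M (w.map .terminal) := by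
      simp [formLang]
    rw [h, Language.mem_mul]
    constructor
    · rintro ⟨y, rfl, z, hz, rfl⟩
      rw [ih.1 hz, List.singleton_append]
    · rintro rfl
      exact ⟨[a], rfl, w, ih.2 rfl, rfl⟩

lemma mem_formLang_terminal {a : T} {x : List T} :
    x ∈ formLang M [.terminal a] ↔ x = [a] :=
  mem_formLang_terminals (w := [a])

/-- If an interpretation of the nonterminals is closed under the rules, then the languages of the
sentential forms decrease along derivations. -/
lemma Derives.formLang_le {g : ContextFreeGrammar T} {M : g.NT → Language T}
    (hM : ∀ p ∈ g.rules, formLang M p.output ≤ M p.input) {s t : List (Symbol T g.NT)}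
    (h : g.Derives s t) : formLang M t ≤ formLang M s := by
  induction h with
  | refl => exact le_rfl
  | tail _ hp ih =>
    refine le_trans ?_ ih
    obtain ⟨p, hp, hr⟩ := hp
    obtain ⟨x, y, rfl, rfl⟩ := hr.exists_parts
    simp only [formLang_append, formLang_nonterminal]
    exact mul_le_mul' (mul_le_mul' le_rfl (hM p hp)) le_rfl

lemma mem_of_derives {g : ContextFreeGrammar T} {M : g.NT → Language T}
    (hM : ∀ p ∈ g.rules, formLang M p.output ≤ M p.input) {A : g.NT} {w : List T}
    (h : g.Derives [.nonterminal A] (w.map .terminal)) : w ∈ M A := by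
  have := h.formLang_le hM
  rw [formLang_nonterminal] at this
  exact this (mem_formLang_terminals.2 rfl)

lemma Derives.append {g : ContextFreeGrammar T} {s s' t t' : List (Symbol T g.NT)}
    (h : g.Derives s s') (h' : g.Derives t t') : g.Derives (s ++ t) (s' ++ t') :=
  (h.append_right t).trans (h'.append_left s')

lemma derives_output {g : ContextFreeGrammar T} {p : ContextFreeRule T g.NT} (hp : p ∈ g.rules) :
    g.Derives [.nonterminal p.input] p.output :=
  Produces.single ⟨p, hp, ContextFreeRule.Rewrites.input_output⟩

end Interpretation

section ChomskyNormalForm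

variable {T : Type*} (g : ContextFreeGrammar T)

/-- The language of the words derivable from the nonterminal `A`. -/
def langFrom (A : g.NT) : Language T :=
  {w | g.Derives [.nonterminal A] (w.map .terminal)}

variable {g}

lemma mul_langFrom_le {p : ContextFreeRule T g.NT} (hp : p ∈ g.rules) {B C : g.NT}
    (h : p.output = [.nonterminal B, .nonterminal C]) :
    g.langFrom B * g.langFrom C ≤ g.langFrom p.input := by
  intro w hw
  obtain ⟨b, hb, c, hc, rfl⟩ := Language.mem_mul.1 hw
  have h1 := derives_output hp
  rw [h] at h1
  have h2 := h1.trans (Derives.append (s := [.nonterminal B]) hb hc)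
  simpa [langFrom] using h2

lemma IsCNF.ne_nil (hg : g.IsCNF) {A : g.NT} {x : List T} (hx : x ∈ g.langFrom A) : x ≠ [] := by
  refine mem_of_derives (M := fun _ ↦ ({w : List T | w ≠ []} : Language T)) (fun p hp ↦ ?_) hx
  rcases hg p hp with ⟨a, ha⟩ | ⟨B, C, hBC⟩
  · rw [ha]
    intro x hx
    obtain rfl := mem_formLang_terminal.1 hx
    exact List.cons_ne_nil _ _
  · rw [hBC]
    intro w hw
    obtain ⟨b, hb, c, -, rfl⟩ := mem_formLang_pair.1 hw
    exact List.append_ne_nil_of_left_ne_nil hb c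

/-- The first step of a derivation of a word by a grammar in Chomsky normal form. The words that
satisfy the disjunction, taken as the language of `A`, are closed under the rules, so no derivation
has to be taken apart. -/
lemma IsCNF.cases_langFrom (hg : g.IsCNF) {A : g.NT} {x : List T} (hx : x ∈ g.langFrom A) :
    (∃ p ∈ g.rules, p.input = A ∧ ∃ a, p.output = [.terminal a] ∧ x = [a]) ∨
    (∃ p ∈ g.rules, p.input = A ∧ ∃ B C, p.output = [.nonterminal B, .nonterminal C] ∧
      ∃ b ∈ g.langFrom B, ∃ c ∈ g.langFrom C, x = b ++ c) := by
  let M : g.NT → Language T := fun A ↦ {x |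
    (∃ p ∈ g.rules, p.input = A ∧ ∃ a, p.output = [.terminal a] ∧ x = [a]) ∨
    (∃ p ∈ g.rules, p.input = A ∧ ∃ B C, p.output = [.nonterminal B, .nonterminal C] ∧
      ∃ b ∈ g.langFrom B, ∃ c ∈ g.langFrom C, x = b ++ c)}
  have hle : ∀ A, M A ≤ g.langFrom A := by
    rintro A x (⟨p, hp, rfl, a, ha, rfl⟩ | ⟨p, hp, rfl, B, C, hBC, b, hb, c, hc, rfl⟩)
    · have := derives_output hp
      rwa [ha] at this
    · exact mul_langFrom_le hp hBC (Language.append_mem_mul hb hc)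
  refine mem_of_derives (M := M) (fun p hp ↦ ?_) hx
  rcases hg p hp with ⟨a, ha⟩ | ⟨B, C, hBC⟩
  · rw [ha]
    intro x hx
    obtain rfl := mem_formLang_terminal.1 hx
    exact Or.inl ⟨p, hp, rfl, a, ha, rfl⟩
  · rw [hBC]
    intro w hw
    obtain ⟨b, hb, c, hc, rfl⟩ := mem_formLang_pair.1 hw
    exact Or.inr ⟨p, hp, rfl, B, C, hBC, b, hle B hb, c, hle C hc, rfl⟩

end ChomskyNormalForm

end ContextFreeGrammar

/-! ### Families of languages in which long words split -/

section Spines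

variable {ι Δ : Type*} (L : ι → Language Δ)

/-- A family of languages splits if every word of length at least `2` in a member `L X` is a
product of nonempty words from two members whose product is contained in `L X`. -/
def Splits : Prop :=
  ∀ X, ∀ w ∈ L X, 2 ≤ w.length →
    ∃ B C, L B * L C ≤ L X ∧ ∃ u ∈ L B, ∃ v ∈ L C, u ≠ [] ∧ v ≠ [] ∧ w = u ++ v

/-- Nonterminals of the double Greibach normal form of a family of languages: the members of the
family, and the residuals of one member by another, on either side. -/
inductive DGNFIndex (ι : Type*)
  | full (X : ι)
  | right (X Y : ι)
  | left (X Y : ι)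

/-- The languages of the nonterminals: `right X Y` stands for the words that may follow `L Y`
inside `L X`, and `left X Y` for those that may precede it. -/
def residualLang : DGNFIndex ι → Language Δ
  | .full X => L X
  | .right X Y => {w | ∀ y ∈ L Y, y ++ w ∈ L X}
  | .left X Y => {w | ∀ y ∈ L Y, w ++ y ∈ L X}

/-- `RightOfSpine L X Y w`: in a binary tree rooted at `X`, the leftmost branch passes through a
node `Y`, and `w` is read to the right of that node. All the words hanging off the branch are
nonempty. The constructor `step` adds the sibling of the lowest node. -/
inductive RightOfSpine : ι → ι → List Δ → Prop
  | refl (X : ι) : RightOfSpine X X []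
  | step {X Y Z C : ι} {v w : List Δ} (h : L Y * L C ≤ L Z) (hv : v ∈ L C) (hv0 : v ≠ [])
      (hw : RightOfSpine X Z w) : RightOfSpine X Y (v ++ w)

/-- The mirror image of `RightOfSpine`: `w` is read to the left of a node `Y` on the rightmost
branch of a binary tree rooted at `X`. -/
inductive LeftOfSpine : ι → ι → List Δ → Prop
  | refl (X : ι) : LeftOfSpine X X []
  | step {X Y Z C : ι} {v w : List Δ} (h : L C * L Y ≤ L Z) (hv : v ∈ L C) (hv0 : v ≠ [])
      (hw : LeftOfSpine X Z w) : LeftOfSpine X Y (w ++ v)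

variable {L}

lemma append_mem_of_mul_le {A B X : ι} (h : L A * L B ≤ L X) {u v : List Δ} (hu : u ∈ L A)
    (hv : v ∈ L B) : u ++ v ∈ L X :=
  h (Language.append_mem_mul hu hv)

lemma RightOfSpine.mem {X Y : ι} {w : List Δ} (h : RightOfSpine L X Y w) :
    w ∈ residualLang L (.right X Y) := by
  induction h with
  | refl => intro y hy; simpa using hy
  | step h hv _ _ ih =>
    intro y hy
    rw [← List.append_assoc]
    exact ih _ (append_mem_of_mul_le h hy hv)

lemma LeftOfSpine.mem {X Y : ι} {w : List Δ} (h : LeftOfSpine L X Y w) :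
    w ∈ residualLang L (.left X Y) := by
  induction h with
  | refl => intro y hy; simpa using hy
  | step h hv _ _ ih =>
    intro y hy
    rw [List.append_assoc]
    exact ih _ (append_mem_of_mul_le h hv hy)

/-- A spine extended by a new root. -/
lemma RightOfSpine.extend {X Y B C : ι} {v w : List Δ} (hw : RightOfSpine L B Y w)
    (h : L B * L C ≤ L X) (hv : v ∈ L C) (hv0 : v ≠ []) : RightOfSpine L X Y (w ++ v) := by
  induction hw with
  | refl => simpa using RightOfSpine.step h hv hv0 (.refl X)
  | step h' hv' hv0' _ ih =>
    rw [List.append_assoc]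
    exact .step h' hv' hv0' ih

lemma LeftOfSpine.extend {X Y B C : ι} {v w : List Δ} (hw : LeftOfSpine L B Y w)
    (h : L C * L B ≤ L X) (hv : v ∈ L C) (hv0 : v ≠ []) : LeftOfSpine L X Y (v ++ w) := by
  induction hw with
  | refl => simpa using LeftOfSpine.step h hv hv0 (.refl X)
  | step h' hv' hv0' _ ih =>
    rw [← List.append_assoc]
    exact .step h' hv' hv0' ih

/-- A nontrivial spine loses its root. -/
lemma RightOfSpine.eq_nil_or {X Y : ι} {w : List Δ} (h : RightOfSpine L X Y w) :
    (X = Y ∧ w = []) ∨ ∃ B D, L B * L D ≤ L X ∧ ∃ m, RightOfSpine L B Y m ∧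
      ∃ d ∈ L D, d ≠ [] ∧ w = m ++ d := by
  induction h with
  | refl => exact .inl ⟨rfl, rfl⟩
  | @step Y Z C v w h hv hv0 _ ih =>
    right
    rcases ih with ⟨rfl, rfl⟩ | ⟨B, D, hBD, m, hm, d, hd, hd0, rfl⟩
    · exact ⟨Y, C, h, [], .refl Y, v, hv, hv0, by simp⟩
    · exact ⟨B, D, hBD, v ++ m, .step h hv hv0 hm, d, hd, hd0, by simp⟩

lemma LeftOfSpine.eq_nil_or {X Y : ι} {w : List Δ} (h : LeftOfSpine L X Y w) :
    (X = Y ∧ w = []) ∨ ∃ B D, L D * L B ≤ L X ∧ ∃ m, LeftOfSpine L B Y m ∧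
      ∃ d ∈ L D, d ≠ [] ∧ w = d ++ m := by
  induction h with
  | refl => exact .inl ⟨rfl, rfl⟩
  | @step Y Z C v w h hv hv0 _ ih =>
    right
    rcases ih with ⟨rfl, rfl⟩ | ⟨B, D, hBD, m, hm, d, hd, hd0, rfl⟩
    · exact ⟨Y, C, h, [], .refl Y, v, hv, hv0, by simp⟩
    · exact ⟨B, D, hBD, m ++ v, .step h hv hv0 hm, d, hd, hd0, by simp⟩

/-- The left corner of a word: the leftmost branch of a tree for it ends in its first letter. -/
lemma Splits.exists_rightOfSpine (hL : Splits L) {X : ι} {w : List Δ} (hw : w ∈ L X)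
    (hw0 : w ≠ []) : ∃ a u Y, w = a :: u ∧ [a] ∈ L Y ∧ RightOfSpine L X Y u := by
  induction hn : w.length using Nat.strong_induction_on generalizing X w with
  | _ n ih =>
    subst hn
    match w, hw0 with
    | [a], _ => exact ⟨a, [], X, rfl, hw, .refl X⟩
    | a :: b :: t, _ =>
      obtain ⟨B, C, hBC, u, hu, v, hv, hu0, hv0, huv⟩ := hL X _ hw (by simp)
      have hlt : u.length < (a :: b :: t).length := by
        rw [huv, List.length_append]
        have := List.length_pos_iff.2 hv0
        omega
      obtain ⟨a', u', Y, rfl, ha, hs⟩ := ih _ hlt hu hu0 rfl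
      exact ⟨a', u' ++ v, Y, by rw [huv]; rfl, ha, hs.extend hBC hv hv0⟩

lemma Splits.exists_leftOfSpine (hL : Splits L) {X : ι} {w : List Δ} (hw : w ∈ L X)
    (hw0 : w ≠ []) : ∃ a u Y, w = u ++ [a] ∧ [a] ∈ L Y ∧ LeftOfSpine L X Y u := by
  induction hn : w.length using Nat.strong_induction_on generalizing X w with
  | _ n ih =>
    subst hn
    match w, hw0 with
    | [a], _ => exact ⟨a, [], X, rfl, hw, .refl X⟩
    | a :: b :: t, _ =>
      obtain ⟨B, C, hBC, u, hu, v, hv, hu0, hv0, huv⟩ := hL X _ hw (by simp)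
      have hlt : v.length < (a :: b :: t).length := by
        rw [huv, List.length_append]
        have := List.length_pos_iff.2 hu0
        omega
      obtain ⟨a', v', Y, rfl, ha, hs⟩ := ih _ hlt hv hv0 rfl
      exact ⟨a', u ++ v', Y, by rw [huv, List.append_assoc], ha, hs.extend hBC hu hu0⟩

variable (L)

/-- The rule `A → a P Q R b` is sound for the languages `residualLang L`. -/
def IsSoundNode (A P Q R : DGNFIndex ι) (a b : Δ) : Prop :=
  ∀ p ∈ residualLang L P, ∀ q ∈ residualLang L Q, ∀ s ∈ residualLang L R,
    a :: (p ++ q ++ s ++ [b]) ∈ residualLang L A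

/-- The words generated from the nonterminals by all sound rules of the forms `A → ε`, `A → a` and
`A → a P Q R b`. -/
inductive SoundGen : DGNFIndex ι → List Δ → Prop
  | nil {A} (h : [] ∈ residualLang L A) : SoundGen A []
  | single {A a} (h : [a] ∈ residualLang L A) : SoundGen A [a]
  | node {A P Q R a b p q s} (h : IsSoundNode L A P Q R a b) (hp : SoundGen P p)
      (hq : SoundGen Q q) (hs : SoundGen R s) : SoundGen A (a :: (p ++ q ++ s ++ [b]))

variable {L}

/-- The form of the recursion: a word `v ++ m ++ d` loses its first and its last letter, the former
being the left corner of `v`, the latter the right corner of `d`. -/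
lemma Splits.soundGen_append (hL : Splits L) {A Q : DGNFIndex ι} {C D : ι} {v m d : List Δ}
    (ihr : ∀ X Y w, w.length < (v ++ m ++ d).length → RightOfSpine L X Y w →
      SoundGen L (.right X Y) w)
    (ihl : ∀ X Y w, w.length < (v ++ m ++ d).length → LeftOfSpine L X Y w →
      SoundGen L (.left X Y) w)
    (hv : v ∈ L C) (hv0 : v ≠ []) (hd : d ∈ L D) (hd0 : d ≠ []) (hm : SoundGen L Q m)
    (hA : ∀ v ∈ L C, ∀ m ∈ residualLang L Q, ∀ d ∈ L D, v ++ m ++ d ∈ residualLang L A) :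
    SoundGen L A (v ++ m ++ d) := by
  obtain ⟨a, p, Y, rfl, ha, hp⟩ := hL.exists_rightOfSpine hv hv0
  obtain ⟨b, s, Z, rfl, hb, hs⟩ := hL.exists_leftOfSpine hd hd0
  have h1 := ihr _ _ _ (by simp) hp
  have h2 := ihl _ _ _ (by simp; omega) hs
  have key : IsSoundNode L A (.right C Y) Q (.left D Z) a b := by
    intro p hp q hq s hs
    simpa using hA _ (hp _ ha) q hq _ (hs _ hb)
  simpa using SoundGen.node key h1 hm h2

/-- The sound rules generate every word of the family, and every word read beside a spine. -/
theorem Splits.soundGen (hL : Splits L) (w : List Δ) :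
    (∀ X, w ∈ L X → SoundGen L (.full X) w) ∧
    (∀ X Y, RightOfSpine L X Y w → SoundGen L (.right X Y) w) ∧
    (∀ X Y, LeftOfSpine L X Y w → SoundGen L (.left X Y) w) := by
  induction hn : w.length using Nat.strong_induction_on generalizing w with
  | _ n ih =>
    subst hn
    -- Words of length less than `2` are covered by the rules `A → ε` and `A → a`.
    have short : ∀ A, w ∈ residualLang L A → w.length < 2 → SoundGen L A w := by
      intro A hw hlt
      match w with
      | [] => exact .nil hw
      | [a] => exact .single hw
      | a :: b :: t => simp at hlt
    have ihr : ∀ X Y v, v.length < w.length → RightOfSpine L X Y v → SoundGen L (.right X Y) v :=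
      fun X Y v hv ↦ (ih _ hv v rfl).2.1 X Y
    have ihl : ∀ X Y v, v.length < w.length → LeftOfSpine L X Y v → SoundGen L (.left X Y) v :=
      fun X Y v hv ↦ (ih _ hv v rfl).2.2 X Y
    -- A nonterminal whose language contains `L C` generates the words of `L C` by splitting them.
    have split : ∀ A C, (∀ v ∈ L C, v ∈ residualLang L A) → w ∈ L C → SoundGen L A w := by
      intro A C hCA hw
      by_cases hlt : w.length < 2
      · exact short A (hCA w hw) hlt
      obtain ⟨D, E, hDE, u, hu, v, hv, hu0, hv0, rfl⟩ := hL C w hw (by omega)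
      have hnil : SoundGen L (.right D D) [] := .nil (RightOfSpine.refl D).mem
      have := hL.soundGen_append (A := A) (m := []) (by simpa using ihr) (by simpa using ihl)
        hu hu0 hv hv0 hnil
        (fun u hu m hm v hv ↦ hCA _ (append_mem_of_mul_le hDE (hm u hu) hv))
      simpa using this
    refine ⟨fun X hw ↦ split _ X (fun _ h ↦ h) hw, fun X Y hw ↦ ?_, fun X Y hw ↦ ?_⟩
    · cases hw with
      | refl => exact .nil (RightOfSpine.refl X).mem
      | @step _ Z C v w h hv hv0 hw =>
        rcases hw.eq_nil_or with ⟨rfl, rfl⟩ | ⟨B, D, hBD, m, hm, d, hd, hd0, rfl⟩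
        · rw [List.append_nil] at split
          rw [List.append_nil]
          exact split _ C (fun v hv y hy ↦ append_mem_of_mul_le h hy hv) hv
        · have hmlt : m.length < (v ++ (m ++ d)).length := by
            have := List.length_pos_iff.2 hv0
            simp; omega
          have hQ := ihr _ _ _ hmlt hm
          rw [← List.append_assoc] at ihr ihl ⊢
          refine hL.soundGen_append ihr ihl hv hv0 hd hd0 hQ fun v hv m hm d hd y hy ↦ ?_
          have := append_mem_of_mul_le hBD (hm _ (append_mem_of_mul_le h hy hv)) hd
          simpa using this
    · cases hw with
      | refl => exact .nil (LeftOfSpine.refl X).mem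
      | @step _ Z C v w h hv hv0 hw =>
        rcases hw.eq_nil_or with ⟨rfl, rfl⟩ | ⟨B, D, hBD, m, hm, d, hd, hd0, rfl⟩
        · rw [List.nil_append] at split
          rw [List.nil_append]
          exact split _ C (fun v hv y hy ↦ append_mem_of_mul_le h hv hy) hv
        · have hmlt : m.length < (d ++ m ++ v).length := by
            have := List.length_pos_iff.2 hv0
            simp; omega
          have hQ := ihl _ _ _ hmlt hm
          refine hL.soundGen_append ihr ihl hd hd0 hv hv0 hQ fun d hd m hm v hv y hy ↦ ?_
          have := append_mem_of_mul_le hBD hd (hm _ (append_mem_of_mul_le h hv hy))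
          simpa using this

end Spines

/-! ### Words cut into blocks -/

section Blocks

variable {T : Type*} {r : ℕ}

/-- The word over `T` spelled by a word over the alphabet `Σ^r` of blocks. -/
def unblock (w : List (List.Vector T r)) : List T :=
  w.flatMap List.Vector.toList

@[simp] lemma unblock_nil : unblock ([] : List (List.Vector T r)) = [] := rfl

@[simp] lemma unblock_cons (a : List.Vector T r) (w : List (List.Vector T r)) :
    unblock (a :: w) = a.toList ++ unblock w := rfl

@[simp] lemma unblock_append (v w : List (List.Vector T r)) :
    unblock (v ++ w) = unblock v ++ unblock w := by
  simp [unblock]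

lemma length_unblock (w : List (List.Vector T r)) : (unblock w).length = w.length * r := by
  induction w with
  | nil => simp
  | cons a w ih => simp [ih]; ring

lemma exists_toList_eq {w : List T} (hw : w.length = r) : ∃ a : List.Vector T r, a.toList = w :=
  ⟨⟨w, hw⟩, rfl⟩

lemma exists_unblock_append (hr : 1 ≤ r) (x : List T) :
    ∃ (w : List (List.Vector T r)) (v : List T), v.length < r ∧ x = unblock w ++ v := by
  induction hn : x.length using Nat.strong_induction_on generalizing x with
  | _ n ih =>
    subst hn
    by_cases hx : x.length < r
    · exact ⟨[], x, hx, rfl⟩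
    · obtain ⟨w, v, hv, h⟩ := ih (x.drop r).length (by simp; omega) _ rfl
      obtain ⟨a, ha⟩ := exists_toList_eq (w := x.take r) (r := r) (by simp; omega)
      refine ⟨a :: w, v, hv, ?_⟩
      rw [unblock_cons, List.append_assoc, ← h, ha]
      exact (List.take_append_drop r x).symm

lemma exists_of_unblock_append_eq {w w' : List (List.Vector T r)} {t v : List T}
    (hv : v.length < r) (h : unblock w ++ t = unblock w' ++ v) :
    ∃ w'', w' = w ++ w'' ∧ t = unblock w'' ++ v := by
  induction w generalizing w' with
  | nil => exact ⟨w', rfl, h⟩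
  | cons a w ih =>
    cases w' with
    | nil =>
      have := congrArg List.length h
      simp at this
      omega
    | cons b w' =>
      simp only [unblock_cons, List.append_assoc] at h
      obtain ⟨h1, h2⟩ := List.append_inj h (by simp)
      obtain ⟨w'', rfl, ht⟩ := ih h2
      exact ⟨w'', by rw [List.Vector.eq _ _ h1]; rfl, ht⟩

/-- The words of length less than `r` can be indexed by a type `Q` in the lowest universe, with at
most `|Σ|^r` elements if `|Σ| ≥ 2`, and with `r` elements if `|Σ| = 1`. -/
lemma exists_index_short (T : Type*) [Finite T] [Nonempty T] (r : ℕ) :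
    ∃ (Q : Type) (_ : Finite Q) (word : Q → List T), (∀ q, (word q).length < r) ∧
      (∀ v : List T, v.length < r → ∃ q, word q = v) ∧
      Nat.card Q ≤ (if 2 ≤ Nat.card T then 1 else r) * Nat.card T ^ r := by
  have := Fintype.ofFinite T
  let W := Σ n : Fin r, List.Vector T n
  let e : Fin (Fintype.card W) ≃ W := (Fintype.equivFin W).symm
  refine ⟨_, inferInstance, fun q ↦ (e q).2.toList, fun q ↦ by simp, fun v hv ↦ ?_, ?_⟩
  · obtain ⟨a, ha⟩ := exists_toList_eq (w := v) (r := v.length) rfl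
    exact ⟨e.symm ⟨⟨v.length, hv⟩, a⟩,
      (congrArg (fun y : W ↦ y.2.toList) (e.apply_symm_apply _)).trans ha⟩
  · have hW : Fintype.card W = ∑ n ∈ Finset.range r, Fintype.card T ^ n := by
      rw [← Fin.sum_univ_eq_sum_range (fun n ↦ Fintype.card T ^ n), Fintype.card_sigma]
      simp
    rw [Nat.card_eq_fintype_card, Fintype.card_fin, hW, Nat.card_eq_fintype_card]
    split_ifs with h
    · rw [one_mul]
      exact (Nat.geomSum_lt h (by simp)).le
    · have : Fintype.card T = 1 := by
        have := Fintype.card_pos (α := T)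
        omega
      simp [this]

end Blocks

/-! ### The quotients of the languages of a grammar in Chomsky normal form -/

namespace ContextFreeGrammar

section Quotients

variable {T : Type*} (g : ContextFreeGrammar T) (r : ℕ) {Q : Type} (word : Q → List T)

/-- The two-sided quotient `u · L(A) · v⁻¹`, where `u` and `v` are the words with the indices
`X.1` and `X.2.2` and `A` is the nonterminal `X.2.1`, restricted to words whose length is a multiple
of `r` and read as a language over the alphabet `Σ^r`. -/
def quotientLang (X : Q × g.NT × Q) : Language (List.Vector T r) :=
  {w | ∃ x ∈ g.langFrom X.2.1, word X.1 ++ x = unblock w ++ word X.2.2}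

variable {g r word}

lemma mul_quotientLang_le {p : ContextFreeRule T g.NT} (hp : p ∈ g.rules) {B C : g.NT}
    (h : p.output = [.nonterminal B, .nonterminal C]) (u z v : Q) :
    g.quotientLang r word (u, B, z) * g.quotientLang r word (z, C, v) ≤
      g.quotientLang r word (u, p.input, v) := by
  intro w hw
  obtain ⟨w1, ⟨b, hb, h1⟩, w2, ⟨c, hc, h2⟩, rfl⟩ := Language.mem_mul.1 hw
  refine ⟨b ++ c, mul_langFrom_le hp h (Language.append_mem_mul hb hc), ?_⟩
  simp only at h1 h2 ⊢
  rw [← List.append_assoc, h1, List.append_assoc, h2, unblock_append, List.append_assoc]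

/-- A word of a quotient has at most one block if it comes from a rule `A → a`; otherwise it is cut
along a rule `A → BC`. -/
lemma IsCNF.cases_quotientLang (hg : g.IsCNF) (hr : 1 ≤ r) (hQ : ∀ q, (word q).length < r)
    (hQ' : ∀ v : List T, v.length < r → ∃ q, word q = v) {u v : Q} {A : g.NT} {x : List T}
    {w : List (List.Vector T r)} (hx : x ∈ g.langFrom A)
    (h : word u ++ x = unblock w ++ word v) :
    (∃ p ∈ g.rules, p.input = A ∧ ∃ a, p.output = [.terminal a] ∧ x = [a] ∧ w.length ≤ 1) ∨
    ∃ p ∈ g.rules, p.input = A ∧ ∃ B C, p.output = [.nonterminal B, .nonterminal C] ∧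
      ∃ z, ∃ b ∈ g.langFrom B, ∃ c ∈ g.langFrom C, ∃ w₁ w₂, w = w₁ ++ w₂ ∧
        b.length < x.length ∧ c.length < x.length ∧
        word u ++ b = unblock w₁ ++ word z ∧ word z ++ c = unblock w₂ ++ word v := by
  rcases hg.cases_langFrom hx with ⟨p, hp, hA, a, ha, rfl⟩ |
    ⟨p, hp, hA, B, C, hBC, b, hb, c, hc, rfl⟩
  · refine .inl ⟨p, hp, hA, a, ha, rfl, ?_⟩
    have hl := congrArg List.length h
    simp only [List.length_append, List.length_singleton, length_unblock] at hl
    have := hQ u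
    by_contra hw
    have : 2 * r ≤ w.length * r := Nat.mul_le_mul_right r (by omega)
    omega
  · obtain ⟨w₁, t, ht, h1⟩ := exists_unblock_append hr (word u ++ b)
    obtain ⟨z, rfl⟩ := hQ' t ht
    rw [← List.append_assoc, h1, List.append_assoc] at h
    obtain ⟨w₂, rfl, h2⟩ := exists_of_unblock_append_eq (hQ v) h
    have hb0 := List.length_pos_iff.2 (hg.ne_nil hb)
    have hc0 := List.length_pos_iff.2 (hg.ne_nil hc)
    exact .inr ⟨p, hp, hA, B, C, hBC, z, b, hb, c, hc, w₁, w₂, rfl, by simp; omega,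
      by simp; omega, h1, h2⟩

lemma IsCNF.splits_quotientLang (hg : g.IsCNF) (hr : 1 ≤ r) (hQ : ∀ q, (word q).length < r)
    (hQ' : ∀ v : List T, v.length < r → ∃ q, word q = v) :
    Splits (g.quotientLang r word) := by
  rintro ⟨u, A, v⟩ w ⟨x, hx, h⟩ hw
  simp only at hx h
  induction hn : x.length using Nat.strong_induction_on generalizing u A v w x with
  | _ n ih =>
    subst hn
    rcases hg.cases_quotientLang hr hQ hQ' hx h with ⟨_, _, _, _, _, _, hle⟩ |
      ⟨p, hp, rfl, B, C, hBC, z, b, hb, c, hc, w₁, w₂, rfl, hbx, hcx, h1, h2⟩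
    · omega
    have hmul := mul_quotientLang_le (r := r) (word := word) hp hBC u z v
    have m1 : w₁ ∈ g.quotientLang r word (u, B, z) := ⟨b, hb, h1⟩
    have m2 : w₂ ∈ g.quotientLang r word (z, C, v) := ⟨c, hc, h2⟩
    -- If one factor is empty, the language of the other nonterminal is contained in that of `A`,
    -- and the word splits there, with a shorter `x`.
    rcases eq_or_ne w₁ [] with rfl | hw1
    · obtain ⟨D, E, hDE, rest⟩ := ih _ hcx z C v w₂ c hc h2 (by simpa using hw) rfl
      exact ⟨D, E, hDE.trans fun y hy ↦ hmul (Language.append_mem_mul m1 hy), rest⟩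
    rcases eq_or_ne w₂ [] with rfl | hw2
    · obtain ⟨D, E, hDE, s, hs, t, ht, hs0, ht0, hst⟩ :=
        ih _ hbx u B z w₁ b hb h1 (by simpa using hw) rfl
      refine ⟨D, E, hDE.trans fun y hy ↦ ?_, s, hs, t, ht, hs0, ht0, by simpa using hst⟩
      simpa using hmul (Language.append_mem_mul hy m2)
    exact ⟨_, _, hmul, w₁, m1, w₂, m2, hw1, hw2, rfl⟩

/-- A word is generated by `g` if and only if it belongs, up to a suffix shorter than `r`, to a
quotient of the language of the axiom. -/
lemma mem_language_iff_quotientLang (hr : 1 ≤ r)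
    (hQ' : ∀ v : List T, v.length < r → ∃ q, word q = v)
    {e : Q} (he : word e = []) {x : List T} :
    x ∈ g.language ↔
      ∃ q, ∃ w ∈ g.quotientLang r word (e, g.initial, q), x = unblock w ++ word q := by
  constructor
  · intro hx
    obtain ⟨w, v, hv, h⟩ := exists_unblock_append hr x
    obtain ⟨q, rfl⟩ := hQ' v hv
    exact ⟨q, w, ⟨x, hx, by simpa [he] using h⟩, h⟩
  · rintro ⟨q, w, ⟨x', hx', h⟩, rfl⟩
    simp only [he, List.nil_append] at h
    exact h ▸ hx'

end Quotients

/-! ### The quotiented Chomsky normal form -/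

section QuotientGrammar

/-- The elements related to the indices in a finite type form a finite set, with at most as many
elements as there are indices, if each index is related to at most one element. -/
lemma exists_finset_card_le {I α : Type*} [Finite I] (R : I → α → Prop)
    (hR : ∀ i x y, R i x → R i y → x = y) :
    ∃ F : Finset α, (∀ x, x ∈ F ↔ ∃ i, R i x) ∧ F.card ≤ Nat.card I := by
  classical
  have hinj : ∃ f : {x // ∃ i, R i x} → I, Function.Injective f := by
    choose f hf using fun x : {x // ∃ i, R i x} ↦ x.2
    refine ⟨f, fun x y hxy ↦ Subtype.ext (hR (f x) _ _ (hf x) ?_)⟩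
    rw [hxy]
    exact hf y
  obtain ⟨f, hf⟩ := hinj
  have hfin : Finite {x // ∃ i, R i x} := Finite.of_injective f hf
  have hfin' : {x | ∃ i, R i x}.Finite := hfin
  refine ⟨hfin'.toFinset, by simp, ?_⟩
  rw [← Set.ncard_eq_toFinset_card _ hfin']
  exact Nat.card_le_card_of_injective f hf

variable {T : Type*} (g : ContextFreeGrammar T) (r : ℕ) {Q : Type} (word : Q → List T) (e : Q)

/-- The rules of the Q-CNF grammar of `g`. The axiom is `none`, the other nonterminals stand for the
quotients `quotientLang`, and `e` is the index of the empty word. Each rule is tied to a rule `p` of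
`g`, so that there are none if `g` has none, and determined by `p` and at most three indices. -/
inductive QuotientRule : {p // p ∈ g.rules} × (Q ⊕ Q × Q ⊕ Q × Q × Q) →
    ContextFreeRule T (Option (Q × g.NT × Q)) → Prop
  | start (p : {p // p ∈ g.rules}) (v : Q) :
      QuotientRule (p, .inl v)
        ⟨none, .nonterminal (some (e, g.initial, v)) :: (word v).map .terminal⟩
  | letter (p : {p // p ∈ g.rules}) (u v : Q) (a : T) (w : List T)
      (hp : p.1.output = [.terminal a]) (hw : w = [] ∨ w.length = r)
      (h : word u ++ [a] = w ++ word v) :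
      QuotientRule (p, .inr (.inl (u, v))) ⟨some (u, p.1.input, v), w.map .terminal⟩
  | pair (p : {p // p ∈ g.rules}) (u z v : Q) (B C : g.NT)
      (hp : p.1.output = [.nonterminal B, .nonterminal C]) :
      QuotientRule (p, .inr (.inr (u, z, v)))
        ⟨some (u, p.1.input, v), [.nonterminal (some (u, B, z)), .nonterminal (some (z, C, v))]⟩

variable {g r word e}

lemma QuotientRule.unique {i : {p // p ∈ g.rules} × (Q ⊕ Q × Q ⊕ Q × Q × Q)}
    {ρ ρ' : ContextFreeRule T (Option (Q × g.NT × Q))} (h : QuotientRule g r word e i ρ)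
    (h' : QuotientRule g r word e i ρ') : ρ = ρ' := by
  cases h with
  | start p v => cases h'; rfl
  | letter p u v a w hp _ hw =>
    cases h' with
    | letter _ _ _ a' w' hp' _ hw' =>
      obtain rfl : a = a' := by simpa [hp] using hp'
      rw [hw] at hw'
      rw [List.append_cancel_right hw']
  | pair p u z v B C hp =>
    cases h' with
    | pair _ _ _ _ B' C' hp' =>
      obtain ⟨rfl, rfl⟩ : B = B' ∧ C = C' := by simpa [hp] using hp'
      rfl

/-- A sentential form without nonterminals that is empty or a block satisfies the condition on the
rules of a quotiented grammar. -/
lemma exists_flatten_of_map_terminal {N : Type*} {w : List T} (hw : w = [] ∨ w.length = r) :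
    ∃ l : List (List (Symbol T N)), w.map Symbol.terminal = l.flatten ∧
      ∀ b ∈ l, (∃ X : N, b = [Symbol.nonterminal X]) ∨
        (∃ w : List T, w.length = r ∧ b = w.map Symbol.terminal) := by
  rcases hw with rfl | hw
  · exact ⟨[], by simp⟩
  · exact ⟨[w.map .terminal], by simp, fun b hb ↦
      .inr ⟨w, hw, by simpa using hb⟩⟩

/-- Every grammar in Chomsky normal form has an equivalent Q-CNF grammar whose nonterminals, apart
from the axiom, are the triples `(u, A, v)` with `u` and `v` shorter than `r`. -/
theorem IsCNF.exists_isQCNF (hg : g.IsCNF) (hr : 1 ≤ r) [Finite Q]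
    (hQ : ∀ q, (word q).length < r) (hQ' : ∀ v : List T, v.length < r → ∃ q, word q = v) :
    ∃ g' : ContextFreeGrammar T, g'.NT = Option (Q × g.NT × Q) ∧ g'.IsQCNF r ∧
      g'.language = g.language ∧
      g'.rules.card ≤ g.rules.card * (Nat.card Q + (Nat.card Q ^ 2 + Nat.card Q ^ 3)) := by
  obtain ⟨e, he⟩ := hQ' [] (by simp; omega)
  obtain ⟨F, hF, hcard⟩ := exists_finset_card_le (QuotientRule g r word e)
    fun i x y ↦ QuotientRule.unique
  let g' : ContextFreeGrammar T := ⟨Option (Q × g.NT × Q), none, F⟩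
  refine ⟨g', rfl, ⟨⟨?_, ?_, ?_⟩, ?_⟩, ?_, ?_⟩
  · intro ρ hρ
    obtain ⟨i, hi⟩ := (hF ρ).1 hρ
    cases hi <;> simp [g']
  · intro ρ hρ hin
    obtain ⟨i, hi⟩ := (hF ρ).1 hρ
    cases hi with
    | start p v => exact ⟨_, _, hQ v, rfl⟩
    | letter => simp [g'] at hin
    | pair => simp [g'] at hin
  · intro ρ hρ hin
    obtain ⟨i, hi⟩ := (hF ρ).1 hρ
    cases hi with
    | start => exact absurd rfl hin
    | letter p u v a w hp hw h => exact exists_flatten_of_map_terminal hw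
    | pair p u z v B C hp =>
      exact ⟨[[.nonterminal (some (u, B, z))], [.nonterminal (some (z, C, v))]], rfl,
        by simp [g']⟩
  · intro ρ hρ hin
    obtain ⟨i, hi⟩ := (hF ρ).1 hρ
    cases hi with
    | start => exact absurd rfl hin
    | letter p u v a w hp hw h =>
      rcases hw with rfl | hw
      · exact .inr (.inr rfl)
      · exact .inr (.inl ⟨w, hw, rfl⟩)
    | pair p u z v B C hp => exact .inl ⟨_, _, rfl⟩
  · have hlang := @mem_language_iff_quotientLang T g r Q word hr hQ' e he
    let M : g'.NT → Language T := fun A ↦ match A with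
      | none => g.language
      | some X => {x | ∃ w ∈ g.quotientLang r word X, x = unblock w}
    have hM : ∀ ρ ∈ g'.rules, formLang M ρ.output ≤ M ρ.input := by
      intro ρ hρ x hx
      obtain ⟨i, hi⟩ := (hF ρ).1 hρ
      cases hi with
      | start p v =>
        have hx' : x ∈ formLang M ([.nonterminal (some (e, g.initial, v))] ++
          (word v).map .terminal) := hx
        rw [formLang_append, formLang_nonterminal] at hx'
        obtain ⟨_, ⟨w, hw, rfl⟩, y, hy, rfl⟩ := Language.mem_mul.1 hx'
        obtain rfl := mem_formLang_terminals.1 hy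
        exact hlang.2 ⟨v, w, hw, rfl⟩
      | letter p u v a w hp hw h =>
        obtain rfl := mem_formLang_terminals.1 hx
        have ha : [a] ∈ g.langFrom p.1.input := by
          have := derives_output p.2
          rwa [hp] at this
        rcases hw with rfl | hw
        · exact ⟨[], ⟨[a], ha, h⟩, rfl⟩
        · obtain ⟨a', rfl⟩ := exists_toList_eq hw
          exact ⟨[a'], ⟨[a], ha, by simpa using h⟩, by simp⟩
      | pair p u z v B C hp =>
        obtain ⟨_, ⟨w₁, h1, rfl⟩, _, ⟨w₂, h2, rfl⟩, rfl⟩ := mem_formLang_pair.1 hx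
        exact ⟨w₁ ++ w₂, mul_quotientLang_le p.2 hp u z v (Language.append_mem_mul h1 h2), by simp⟩
    have hgen : ∀ n u A v x (w : List (List.Vector T r)), x.length = n → x ∈ g.langFrom A →
        word u ++ x = unblock w ++ word v →
        g'.Derives [.nonterminal (some (u, A, v))] ((unblock w).map .terminal) := by
      intro n
      induction n using Nat.strong_induction_on with
      | _ n ih =>
        rintro u A v x w rfl hx h
        rcases hg.cases_quotientLang hr hQ hQ' hx h with ⟨p, hp, rfl, a, ha, rfl, hle⟩ |
          ⟨p, hp, rfl, B, C, hBC, z, b, hb, c, hc, w₁, w₂, rfl, hbx, hcx, h1, h2⟩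
        · refine derives_output (g := g') (p := ⟨some (u, p.input, v), (unblock w).map .terminal⟩)
            ((hF _).2 ⟨_, .letter ⟨p, hp⟩ u v a _ ha ?_ h⟩)
          match w with
          | [] => exact .inl rfl
          | [a] => exact .inr (by simp)
          | a :: b :: t => simp at hle
        · have hρ := derives_output (g := g') ((hF _).2 ⟨_, .pair ⟨p, hp⟩ u z v B C hBC⟩)
          refine hρ.trans ?_
          have := (ih _ hbx u B z b w₁ rfl hb h1).append (ih _ hcx z C v c w₂ rfl hc h2)
          simpa using this
    ext x
    refine ⟨fun hx ↦ mem_of_derives hM hx, fun hx ↦ ?_⟩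
    obtain ⟨q, w, ⟨y, hy, h⟩, rfl⟩ := hlang.1 hx
    -- The rules for the new axiom exist because `g` has at least one rule.
    obtain ⟨p, hp⟩ : ∃ p, p ∈ g.rules := by
      rcases hg.cases_langFrom hy with ⟨p, hp, -⟩ | ⟨p, hp, -⟩ <;> exact ⟨p, hp⟩
    have hρ := derives_output (g := g') ((hF _).2 ⟨_, .start ⟨p, hp⟩ q⟩)
    refine hρ.trans ?_
    have := (hgen _ e g.initial q y w rfl hy h).append_right ((word q).map .terminal)
    simpa using this
  · refine hcard.trans (le_of_eq ?_)
    simp only [Nat.card_prod, Nat.card_sum, Nat.card_eq_fintype_card, Fintype.card_coe]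
    ring

end QuotientGrammar

end ContextFreeGrammar

/-! ### The quotiented double Greibach normal form -/

section CardDGNFIndex

/-- The three kinds of nonterminals of a double Greibach normal form. -/
def DGNFIndex.equivSum (ι : Type*) : DGNFIndex ι ≃ ι ⊕ ι × ι ⊕ ι × ι where
  toFun
    | .full X => .inl X
    | .right X Y => .inr (.inl (X, Y))
    | .left X Y => .inr (.inr (X, Y))
  invFun
    | .inl X => .full X
    | .inr (.inl (X, Y)) => .right X Y
    | .inr (.inr (X, Y)) => .left X Y
  left_inv A := by cases A <;> rfl
  right_inv A := by rcases A with X | ⟨X, Y⟩ | ⟨X, Y⟩ <;> rfl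

instance {ι : Type*} [Finite ι] : Finite (DGNFIndex ι) :=
  .of_equiv _ (DGNFIndex.equivSum ι).symm

lemma card_DGNFIndex (ι : Type*) [Finite ι] :
    Nat.card (DGNFIndex ι) = Nat.card ι + 2 * Nat.card ι ^ 2 := by
  rw [Nat.card_congr (DGNFIndex.equivSum ι), Nat.card_sum, Nat.card_sum, Nat.card_prod]
  ring

end CardDGNFIndex

namespace ContextFreeGrammar

section SoundGrammar

variable {T ι Q : Type*} {r : ℕ} (L : ι → Language (List.Vector T r)) (word : Q → List T)
  (start : Q → ι)

/-- The rules of the Q-DGNF grammar of a family `L` of languages over the alphabet `Σ^r`: all rules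
of the permitted forms that are sound for the languages `residualLang L`, and rules generating the
words of `L (start q)` followed by `word q` from the axiom `none`. -/
inductive SoundRule : (Q ⊕ DGNFIndex ι ⊕ DGNFIndex ι × List.Vector T r ⊕
    (DGNFIndex ι × DGNFIndex ι × DGNFIndex ι × DGNFIndex ι) × List.Vector T r × List.Vector T r) →
    ContextFreeRule T (Option (DGNFIndex ι)) → Prop
  | start (q : Q) :
      SoundRule (.inl q)
        ⟨none, .nonterminal (some (.full (start q))) :: (word q).map .terminal⟩
  | nil (A : DGNFIndex ι) (h : [] ∈ residualLang L A) :
      SoundRule (.inr (.inl A)) ⟨some A, []⟩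
  | single (A : DGNFIndex ι) (a : List.Vector T r) (h : [a] ∈ residualLang L A) :
      SoundRule (.inr (.inr (.inl (A, a)))) ⟨some A, a.toList.map .terminal⟩
  | node (A P R S : DGNFIndex ι) (a b : List.Vector T r) (h : IsSoundNode L A P R S a b) :
      SoundRule (.inr (.inr (.inr ((A, P, R, S), a, b))))
        ⟨some A, a.toList.map .terminal ++ [some P, some R, some S].map .nonterminal ++
          b.toList.map .terminal⟩

/-- A family of languages over `Σ^r` that splits yields a Q-DGNF grammar. -/
theorem exists_isQDGNF {ι : Type} [Finite T] [Finite ι] [Finite Q]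
    {L : ι → Language (List.Vector T r)} (hL : Splits L) (word : Q → List T) (start : Q → ι)
    (hQ : ∀ q, (word q).length < r) :
    ∃ g : ContextFreeGrammar T, Finite g.NT ∧ g.IsQDGNF r ∧
      (∀ x, x ∈ g.language ↔ ∃ q, ∃ w ∈ L (start q), x = unblock w ++ word q) ∧
      g.rules.card ≤ Nat.card Q + (Nat.card (DGNFIndex ι) +
        (Nat.card (DGNFIndex ι) * Nat.card T ^ r +
          Nat.card (DGNFIndex ι) ^ 4 * (Nat.card T ^ r * Nat.card T ^ r))) := by
  obtain ⟨F, hF, hcard⟩ := exists_finset_card_le (SoundRule L word start) (by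
    intro i x y hx hy
    cases hx <;> cases hy <;> rfl)
  let g : ContextFreeGrammar T := ⟨Option (DGNFIndex ι), none, F⟩
  refine ⟨g, inferInstanceAs (Finite (Option (DGNFIndex ι))), ⟨⟨?_, ?_, ?_⟩, ?_⟩, ?_, ?_⟩
  · intro ρ hρ
    obtain ⟨i, hi⟩ := (hF ρ).1 hρ
    cases hi <;> simp [g]
  · intro ρ hρ hin
    obtain ⟨i, hi⟩ := (hF ρ).1 hρ
    cases hi with
    | start q => exact ⟨_, _, hQ q, rfl⟩
    | nil => simp [g] at hin
    | single => simp [g] at hin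
    | node => simp [g] at hin
  · intro ρ hρ hin
    obtain ⟨i, hi⟩ := (hF ρ).1 hρ
    cases hi with
    | start => exact absurd rfl hin
    | nil A h => exact exists_flatten_of_map_terminal (w := []) (.inl rfl)
    | single A a h => exact exists_flatten_of_map_terminal (.inr (by simp))
    | node A P R S a b h =>
      refine ⟨[a.toList.map .terminal, [.nonterminal (some P)], [.nonterminal (some R)],
        [.nonterminal (some S)], b.toList.map .terminal], by simp, fun c hc ↦ ?_⟩
      simp only [List.mem_cons, List.not_mem_nil, or_false] at hc
      rcases hc with rfl | rfl | rfl | rfl | rfl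
      · exact .inr ⟨a.toList, by simp, rfl⟩
      · exact .inl ⟨_, rfl⟩
      · exact .inl ⟨_, rfl⟩
      · exact .inl ⟨_, rfl⟩
      · exact .inr ⟨b.toList, by simp, rfl⟩
  · intro ρ hρ hin
    obtain ⟨i, hi⟩ := (hF ρ).1 hρ
    cases hi with
    | start => exact absurd rfl hin
    | nil A h => exact .inr (.inr rfl)
    | single A a h => exact .inr (.inl ⟨a.toList, by simp, rfl⟩)
    | node A P R S a b h => exact .inl ⟨a.toList, b.toList, _, by simp, by simp, rfl⟩
  · let M : g.NT → Language T := fun A ↦ match A with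
      | none => {x | ∃ q, ∃ w ∈ L (start q), x = unblock w ++ word q}
      | some A => {x | ∃ w ∈ residualLang L A, x = unblock w}
    have hM : ∀ ρ ∈ g.rules, formLang M ρ.output ≤ M ρ.input := by
      intro ρ hρ x hx
      obtain ⟨i, hi⟩ := (hF ρ).1 hρ
      cases hi with
      | start q =>
        have hx' : x ∈ formLang M ([.nonterminal (some (.full (start q)))] ++
          (word q).map .terminal) := hx
        rw [formLang_append, formLang_nonterminal] at hx'
        obtain ⟨_, ⟨w, hw, rfl⟩, y, hy, rfl⟩ := Language.mem_mul.1 hx'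
        obtain rfl := mem_formLang_terminals.1 hy
        exact ⟨q, w, hw, rfl⟩
      | nil A h =>
        have hx' : x ∈ formLang M (([] : List T).map .terminal) := hx
        obtain rfl := mem_formLang_terminals.1 hx'
        exact ⟨[], h, rfl⟩
      | single A a h =>
        obtain rfl := mem_formLang_terminals.1 hx
        exact ⟨[a], h, by simp⟩
      | node A P R S a b h =>
        have hx' : x ∈ formLang M (a.toList.map .terminal ++
          ([.nonterminal (some P)] ++ [.nonterminal (some R)] ++ [.nonterminal (some S)]) ++
          b.toList.map .terminal) := hx
        simp only [formLang_append, formLang_nonterminal] at hx'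
        obtain ⟨_, h1, _, hb, rfl⟩ := Language.mem_mul.1 hx'
        obtain ⟨_, ha, _, h2, rfl⟩ := Language.mem_mul.1 h1
        obtain ⟨_, h3, _, ⟨s, hs, rfl⟩, rfl⟩ := Language.mem_mul.1 h2
        obtain ⟨_, ⟨p, hp, rfl⟩, _, ⟨q, hq, rfl⟩, rfl⟩ := Language.mem_mul.1 h3
        obtain rfl := mem_formLang_terminals.1 ha
        obtain rfl := mem_formLang_terminals.1 hb
        exact ⟨_, h p hp q hq s hs, by simp⟩
    have hgen : ∀ A w, SoundGen L A w →
        g.Derives [.nonterminal (some A)] ((unblock w).map .terminal) := by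
      intro A w hw
      induction hw with
      | nil h => exact derives_output (g := g) ((hF _).2 ⟨_, .nil _ h⟩)
      | single h => simpa using derives_output (g := g) ((hF _).2 ⟨_, .single _ _ h⟩)
      | @node A P R S a b p q s h _ _ _ ihp ihq ihs =>
        refine (derives_output (g := g) ((hF _).2 ⟨_, .node _ _ _ _ _ _ h⟩)).trans ?_
        have := (((ihp.append ihq).append ihs).append_left
          (a.toList.map .terminal)).append_right (b.toList.map .terminal)
        simpa using this
    refine fun x ↦ ⟨fun hx ↦ mem_of_derives hM hx, ?_⟩
    rintro ⟨q, w, hw, rfl⟩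
    refine (derives_output (g := g) ((hF _).2 ⟨_, .start q⟩)).trans ?_
    have := (hgen _ w ((hL.soundGen w).1 _ hw)).append_right ((word q).map .terminal)
    simpa using this
  · have := Fintype.ofFinite T
    refine hcard.trans (le_of_eq ?_)
    have hV : Nat.card (List.Vector T r) = Nat.card T ^ r := by
      rw [Nat.card_eq_fintype_card, card_vector, Nat.card_eq_fintype_card]
    simp only [Nat.card_prod, Nat.card_sum, hV]
    ring

end SoundGrammar

end ContextFreeGrammar

/-! ### The bounds -/

/-- The rules of the Q-DGNF grammar are counted by the eighth power of the number `n + 1` of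
nonterminals of the Q-CNF grammar: a rule `A → a P R S b` involves four of `n + 2 * n ^ 2` indices. -/
lemma card_rules_dgnf_le {n q t : ℕ} (hq : q ≤ n) (ht : 1 ≤ t) :
    q + ((n + 2 * n ^ 2) + ((n + 2 * n ^ 2) * t + (n + 2 * n ^ 2) ^ 4 * (t * t))) ≤
      21 * (t ^ 6 * (n + 1) ^ 8) := by
  have hm : n + 2 * n ^ 2 ≤ 2 * (n + 1) ^ 2 := by nlinarith
  have h4 : (n + 2 * n ^ 2) ^ 4 ≤ 16 * (n + 1) ^ 8 :=
    (Nat.pow_le_pow_left hm 4).trans (by rw [mul_pow, ← pow_mul]; norm_num)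
  have hN : n + 1 ≤ (n + 1) ^ 8 := Nat.le_self_pow (by norm_num) _
  have hN2 : (n + 1) ^ 2 ≤ (n + 1) ^ 8 := Nat.pow_le_pow_right (by omega) (by norm_num)
  have hn : q ≤ (n + 1) ^ 8 := by omega
  have h1 : n + 2 * n ^ 2 ≤ 2 * (n + 1) ^ 8 := by omega
  have ht1 : t ^ 1 ≤ t ^ 6 := Nat.pow_le_pow_right ht (by norm_num)
  have ht2 : t ^ 2 ≤ t ^ 6 := Nat.pow_le_pow_right ht (by norm_num)
  have ht0 : 1 ≤ t ^ 6 := Nat.one_le_pow _ _ ht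
  have e1 := Nat.mul_le_mul hn ht0
  have e2 := Nat.mul_le_mul h1 ht0
  have e3 := Nat.mul_le_mul h1 ht1
  have e4 := Nat.mul_le_mul h4 ht2
  calc _ = q * 1 + ((n + 2 * n ^ 2) * 1 + ((n + 2 * n ^ 2) * t ^ 1 +
      (n + 2 * n ^ 2) ^ 4 * t ^ 2)) := by ring
    _ ≤ 21 * ((n + 1) ^ 8 * t ^ 6) := by linarith
    _ = _ := by ring

theorem lemma2 :
    ∃ (C : ℕ) (K : ℕ → ℕ), ∀ (T : Type*) [Finite T] [Nonempty T]
      (g : ContextFreeGrammar T) [Finite g.NT], g.IsCNF → ∀ r : ℕ, 1 ≤ r →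
      ∃ (c : ℕ) (g' g'' : ContextFreeGrammar T),
        c = (if 2 ≤ Nat.card T then C else K r) ∧
        Finite g'.NT ∧ Finite g''.NT ∧
        g'.IsQCNF r ∧ g'.language = g.language ∧
        g''.IsQDGNF r ∧ g''.language = g.language ∧
        Nat.card g'.NT ≤ c * (Nat.card g.NT * Nat.card T ^ (2 * r)) ∧
        g'.rules.card ≤ c * (g.rules.card * Nat.card T ^ (3 * r)) ∧
        g''.rules.card ≤ c * (Nat.card T ^ (6 * r) * Nat.card g'.NT ^ 8) ∧
        g''.rules.card ≤ c * (Nat.card T ^ (22 * r) * Nat.card g.NT ^ 8) := by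
  refine ⟨21 * 2 ^ 8, fun r ↦ 21 * 2 ^ 8 * r ^ 16, fun T _ _ g _ hg r hr ↦ ?_⟩
  obtain ⟨Q, _, word, hQ, hQ', hcardQ⟩ := exists_index_short T r
  obtain ⟨e, he⟩ := hQ' [] (by simp; omega)
  obtain ⟨g', hNT, hqcnf, hlang', hrules'⟩ := hg.exists_isQCNF hr hQ hQ'
  have hS := hg.splits_quotientLang hr hQ hQ'
  obtain ⟨g'', hfin, hqdgnf, hlang'', hrules''⟩ :=
    ContextFreeGrammar.exists_isQDGNF hS word (fun q ↦ (e, g.initial, q)) hQ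
  have : Nonempty g.NT := ⟨g.initial⟩
  have : Nonempty Q := ⟨e⟩
  have hcard' : Nat.card g'.NT = Nat.card (Q × g.NT × Q) + 1 := by
    rw [hNT, Finite.card_option]
  have hn : Nat.card (Q × g.NT × Q) = Nat.card Q ^ 2 * Nat.card g.NT := by
    simp only [Nat.card_prod]
    ring
  have hN : 1 ≤ Nat.card g.NT := Nat.card_pos
  have hq1 : 1 ≤ Nat.card Q := Nat.card_pos
  have hT : 1 ≤ Nat.card T := Nat.card_pos
  -- In both cases the constant is `21 * 2 ^ 8 * s ^ 16`, where the number of words shorter than `r`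
  -- is at most `s * |Σ| ^ r`.
  obtain ⟨s, hs⟩ : ∃ s, s = if 2 ≤ Nat.card T then 1 else r := ⟨_, rfl⟩
  have hs1 : 1 ≤ s := by rw [hs]; split_ifs <;> omega
  rw [← hs] at hcardQ
  refine ⟨21 * 2 ^ 8 * s ^ 16, g', g'', ?_, ?_, hfin, hqcnf, hlang', hqdgnf, ?_, ?_⟩
  · rw [hs]
    split_ifs <;> simp
  · rw [hNT]
    infer_instance
  · ext x
    rw [hlang'', ContextFreeGrammar.mem_language_iff_quotientLang hr hQ' he]
  rw [card_DGNFIndex] at hrules''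
  generalize Nat.card g'.NT = N' at *
  generalize Nat.card (Q × g.NT × Q) = n at *
  generalize Nat.card g.NT = N at *
  generalize Nat.card Q = q at *
  simp only [mul_comm _ r, pow_mul]
  have ht : 1 ≤ Nat.card T ^ r := Nat.one_le_pow _ _ hT
  generalize Nat.card T ^ r = t at *
  have hqn : q ≤ n := by
    rw [hn]
    nlinarith [Nat.mul_le_mul hq1 hN, Nat.mul_le_mul (Nat.mul_le_mul (le_refl q) hq1) hN]
  have hN' : N' ≤ 2 * (s ^ 2 * (N * t ^ 2)) := by
    have h1 : q ^ 2 * N ≤ (s * t) ^ 2 * N :=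
      Nat.mul_le_mul_right _ (Nat.pow_le_pow_left hcardQ 2)
    have h2 : 1 ≤ q ^ 2 * N := Nat.one_le_iff_ne_zero.2 (by positivity)
    calc N' ≤ 2 * ((s * t) ^ 2 * N) := by omega
      _ = _ := by ring
  have hpow : ∀ k ≤ 16, s ^ k ≤ s ^ 16 := fun k hk ↦ Nat.pow_le_pow_right hs1 hk
  have hdgnf : g''.rules.card ≤ 21 * (t ^ 6 * N' ^ 8) := by
    rw [hcard']
    exact hrules''.trans (card_rules_dgnf_le hqn ht)
  refine ⟨?_, ?_, ?_, ?_⟩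
  · calc N' ≤ 2 * (s ^ 2 * (N * t ^ 2)) := hN'
      _ ≤ 21 * 2 ^ 8 * (s ^ 16 * (N * t ^ 2)) :=
        Nat.mul_le_mul (by norm_num) (Nat.mul_le_mul_right _ (hpow 2 (by norm_num)))
      _ = _ := by ring
  · have h1 : q ≤ q ^ 3 := Nat.le_self_pow (by norm_num) q
    have h2 : q ^ 2 ≤ q ^ 3 := Nat.pow_le_pow_right hq1 (by norm_num)
    calc g'.rules.card ≤ g.rules.card * (q + (q ^ 2 + q ^ 3)) := hrules'
      _ ≤ g.rules.card * (3 * (s * t) ^ 3) := by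
        refine Nat.mul_le_mul_left _ ?_
        have := Nat.pow_le_pow_left hcardQ 3
        omega
      _ = 3 * (s ^ 3 * (g.rules.card * t ^ 3)) := by ring
      _ ≤ 21 * 2 ^ 8 * (s ^ 16 * (g.rules.card * t ^ 3)) :=
        Nat.mul_le_mul (by norm_num) (Nat.mul_le_mul_right _ (hpow 3 (by norm_num)))
      _ = _ := by ring
  · refine hdgnf.trans (Nat.mul_le_mul_right _ ?_)
    have := Nat.one_le_pow 16 s hs1
    omega
  · calc g''.rules.card ≤ 21 * (t ^ 6 * N' ^ 8) := hdgnf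
      _ ≤ 21 * (t ^ 6 * (2 * (s ^ 2 * (N * t ^ 2))) ^ 8) := by gcongr
      _ = _ := by ring
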